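/- **Setting.** Let $m\ge 1$, let $f_1,\dots,f_m:\mathbb{R}^p\to\mathbb{R}$ be (possibly nonconvex) functions that are $G$-Lipschitz and $L$-smooth (differentiable with $L$-Lipschitz gradient), $L>0$, $G\ge 0$, and let $f(x)=\max_{1\le i\le m} f_i(x)$ satisfy $f(x)\ge f^*>-\infty$ for all $x$. Let $\varepsilon>0$ and $x_0\in\mathbb{R}^p$. A point $x$ is an $\varepsilon$-FOSP of $f$ if $f$ is $L$-weakly convex (for every Fréchet subgradient $u\in\partial f(z)$ and all $z'$: $f(z')\ge f(z)+\langle u,z'-z\rangle-\frac L2\|z'-z\|^2$) and the Moreau envelope $f_{1/(2L)}(x)=\min_{x'} f(x')+L\|x-x'\|^2$ satisfies $\|\nabla f_{1/(2L)}(x)\|\le\varepsilon$ (the minimum being attained and the gradient existing). Put $\tilde\varepsilon=\varepsilon^2/(64L)$ and $$\widehat f(x;z)=\max_{1\le i\le m}\Big[f_i(z)+\langle\nabla f_i(z),x-z\rangle+\tfrac L2\|x-z\|^2\Big].$$ *Prox-FDIAG*: for $k=0,1,\dots$, query the first-order oracle (values and gradients) of all $m$ components at $x_k$, find $x_{k+1}$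 with $\widehat f(x_{k+1};x_k)\le\min_x\widehat f(x;x_k)+\tilde\varepsilon/4$, and return $x_k$ if $f(x_k)-3\tilde\varepsilon/4<\widehat f(x_{k+1};x_k)$. The point $x_{k+1}$ is computed by Nesterov's excessive gap technique for strongly convex max-type problems (entropy distance on the simplex, step parameters $2/(j+3)$, smoothing parameters $4G^2/(L(j+1)(j+2))$), run for a fixed number $N$ of steps. Let $$K=\left\lceil\frac{4^4L\,(f(x_0)-f^*)}{3\varepsilon^2}\right\rceil,\qquad N=\left\lceil 4G\sqrt{\frac{\log m}{L\tilde\varepsilon}}\right\rceil=\left\lceil\frac{2^5G\sqrt{\log m}}{\varepsilon}\right\rceil,\qquad M=\left\lceil\frac{2^4G}{\varepsilon}\,m\log^{3/2}m\right\rceil .$$ **Claim.** 1. For every choice of inner solutions of accuracy $\tilde\varepsilon/4$, Prox-FDIAG returns some $x_k$ with $k\le K$ (that is, after at most $K$ outer steps), and $x_k$ is an $\varepsilon$-FOSP of $f$. 2. For every centre $z$, the excessive gap technique finds in $N$ steps, using no values or gradients of the $f_i$ other than those at $z$, a point $y$ with $\widehat f(y;z)\le\min_x\widehat f(x;z)+\tilde\varepsilon/4$.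 3. Prox-FDIAG with this inner solver returns an $\varepsilon$-FOSP $x_k$ with $k\le K$ (and $k+1\le K$ if $f(x_k)>f^*$). Up to its return, final test included, it makes exactly $(k+1)m$ first-order oracle queries and $(k+1)N$ excessive gap steps. If $m\ge2$, $\varepsilon\le G$ and $f(x_0)>f^*$, then the total number of first-order oracle queries is at most $$K\cdot M=\left\lceil\frac{4^4L\,(f(x_0)-f^*)}{3\varepsilon^2}\right\rceil\cdot\left\lceil\frac{2^4G}{\varepsilon}\,m\log^{3/2}m\right\rceil .$$ If $m\ge 8$, $\varepsilon\le G$ and $f(x_k)>f^*$, the same bound $K\cdot M$ holds when instead every excessive gap step is charged $m$ (one evaluation of each of the $m$ linearised components). -/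

import Mathlib

open scoped InnerProductSpace

/-! ### Smoothness, weak convexity, approximate stationarity -/

/-- `h` is differentiable and its gradient is `L`-Lipschitz. -/
def IsLSmooth {p : ℕ} (L : ℝ) (h : EuclideanSpace ℝ (Fin p) → ℝ) : Prop :=
  Differentiable ℝ h ∧ ∀ x y, ‖gradient h x - gradient h y‖ ≤ L * ‖x - y‖

/-- `u` is a Fréchet subgradient of `h` at `x`:
`liminf_{x' → x, x' ≠ x} (h x' - h x - ⟪u, x' - x⟫) / ‖x' - x‖ ≥ 0`. -/
def IsFrechetSubgradient {p : ℕ} (h : EuclideanSpace ℝ (Fin p) → ℝ)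
    (x u : EuclideanSpace ℝ (Fin p)) : Prop :=
  ∀ η : ℝ, 0 < η → ∀ᶠ x' in nhdsWithin x {x}ᶜ,
    -η ≤ (h x' - h x - ⟪u, x' - x⟫_ℝ) / ‖x' - x‖

/-- `L`-weak convexity through Fréchet subgradients. -/
def IsWeaklyConvex {p : ℕ} (L : ℝ) (h : EuclideanSpace ℝ (Fin p) → ℝ) : Prop :=
  ∀ x u, IsFrechetSubgradient h x u →
    ∀ x', h x + ⟪u, x' - x⟫_ℝ - L / 2 * ‖x' - x‖ ^ 2 ≤ h x'

/-- The Moreau envelope with parameter `lam`. -/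
noncomputable def moreauEnvelope {p : ℕ} (lam : ℝ) (h : EuclideanSpace ℝ (Fin p) → ℝ)
    (x : EuclideanSpace ℝ (Fin p)) : ℝ :=
  ⨅ x', (h x' + 1 / (2 * lam) * ‖x - x'‖ ^ 2)

/-- `x` is an `ε`-first order stationary point of the `L`-weakly convex function `h`: the Moreau
envelope with parameter `1 / (2L)`, whose defining minimum is attained at `x`, is differentiable
at `x` with gradient of norm at most `ε`. -/
def IsEpsFOSP {p : ℕ} (L ε : ℝ) (h : EuclideanSpace ℝ (Fin p) → ℝ)
    (x : EuclideanSpace ℝ (Fin p)) : Prop :=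
  IsWeaklyConvex L h ∧
  (∃ z, IsMinOn (fun x' => h x' + 1 / (2 * (1 / (2 * L))) * ‖x - x'‖ ^ 2) Set.univ z) ∧
  DifferentiableAt ℝ (moreauEnvelope (1 / (2 * L)) h) x ∧
  ‖gradient (moreauEnvelope (1 / (2 * L)) h) x‖ ≤ ε

/-! ### Finite max-type functions and their proximal model -/

/-- The finite max-type function `x ↦ max_i f_i(x)` (used with `0 < m`). -/
noncomputable def maxFun {p m : ℕ} (f : Fin m → EuclideanSpace ℝ (Fin p) → ℝ)
    (x : EuclideanSpace ℝ (Fin p)) : ℝ :=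
  ⨆ i, f i x

/-- The first-order oracle: queried at `(i, x)` it returns `(f_i(x), ∇f_i(x))`. -/
noncomputable def firstOrderOracle {p m : ℕ} (f : Fin m → EuclideanSpace ℝ (Fin p) → ℝ)
    (i : Fin m) (x : EuclideanSpace ℝ (Fin p)) : ℝ × EuclideanSpace ℝ (Fin p) :=
  (f i x, gradient (f i) x)

/-- The affine components at `x`, built from values and gradients `a` at the centre `z`. -/
noncomputable def linComp {p m : ℕ} (a : Fin m → ℝ × EuclideanSpace ℝ (Fin p))
    (z x : EuclideanSpace ℝ (Fin p)) (i : Fin m) : ℝ :=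
  (a i).1 + ⟪(a i).2, x - z⟫_ℝ

/-- The quadratic model with centre `z`, built from values and gradients `a` at `z`:
`max_i (a_i + ⟪g_i, x - z⟫ + L/2 ‖x - z‖²)`. -/
noncomputable def quadModel {p m : ℕ} (L : ℝ) (a : Fin m → ℝ × EuclideanSpace ℝ (Fin p))
    (z x : EuclideanSpace ℝ (Fin p)) : ℝ :=
  ⨆ i, (linComp a z x i + L / 2 * ‖x - z‖ ^ 2)

/-- The quadratic model of `max_i f_i` at `z`, i.e. `\hat f(x; z)`. -/
noncomputable def fHat {p m : ℕ} (L : ℝ) (f : Fin m → EuclideanSpace ℝ (Fin p) → ℝ)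
    (x z : EuclideanSpace ℝ (Fin p)) : ℝ :=
  ⨆ i, (f i z + ⟪gradient (f i) z, x - z⟫_ℝ + L / 2 * ‖x - z‖ ^ 2)

/-- The inner tolerance parameter `ε² / (64 L)`. -/
noncomputable def tolParam (L ε : ℝ) : ℝ := ε ^ 2 / (64 * L)

/-! ### Programs that access the components only through the first-order oracle -/

/-- A program over an oracle indexed by `ι`, queried at points of `E`. It learns about the
components only through `query`; `tick` records the execution of one inner step. -/
inductive OracleProg (ι E α : Type) : Type
  | done (a : α) : OracleProg ι E α
  | query (i : ι) (x : E) (next : ℝ × E → OracleProg ι E α) : OracleProg ι E α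
  | tick (next : OracleProg ι E α) : OracleProg ι E α

/-- Result of running a program: returned value, number of oracle queries, number of inner
steps. -/
structure RunResult (α : Type) : Type where
  value : α
  queries : ℕ
  innerSteps : ℕ

namespace OracleProg

/-- Sequential composition. -/
def bind {ι E α β : Type} : OracleProg ι E α → (α → OracleProg ι E β) → OracleProg ι E β
  | done a, k => k a
  | query i x next, k => query i x (fun r => bind (next r) k)
  | tick next, k => tick (bind next k)

/-- Run a program against the oracle `O`, counting every query and every inner step. -/
def run {ι E α : Type} (O : ι → E → ℝ × E) : OracleProg ι E α → RunResult α
  | done a => ⟨a, 0, 0⟩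
  | query i x next =>
      let r := run O (next (O i x))
      ⟨r.value, r.queries + 1, r.innerSteps⟩
  | tick next =>
      let r := run O next
      ⟨r.value, r.queries, r.innerSteps + 1⟩

/-- Query the components in the list `l` at `x`, storing the answers in the table `acc`. -/
def queryList {ι E : Type} [DecidableEq ι] (x : E) :
    List ι → (ι → ℝ × E) → OracleProg ι E (ι → ℝ × E)
  | [], acc => done acc
  | i :: l, acc => query i x (fun r => queryList x l (Function.update acc i r))

end OracleProg

/-- Query all `m` components at `x`. -/
noncomputable def queryAll {p m : ℕ} (x : EuclideanSpace ℝ (Fin p)) :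
    OracleProg (Fin m) (EuclideanSpace ℝ (Fin p)) (Fin m → ℝ × EuclideanSpace ℝ (Fin p)) :=
  OracleProg.queryList x (List.finRange m) (fun _ => 0)

/-! ### The excessive gap technique for `min_x quadModel L a z x`

The problem is `min_x max_{u ∈ Δ_m} ∑ i, u i * linComp a z x i + L/2 ‖x - z‖²`; the primal part is
`L`-strongly convex, and the simplex `Δ_m` carries the entropy distance with centre the uniform
distribution. -/

/-- The distribution on `Fin m` proportional to `v i * exp (s i)`. -/
noncomputable def tilt {m : ℕ} (v s : Fin m → ℝ) (i : Fin m) : ℝ :=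
  v i * Real.exp (s i) / ∑ j, v j * Real.exp (s j)

/-- The uniform distribution on `Fin m`. -/
noncomputable def unifWeights (m : ℕ) (_i : Fin m) : ℝ := 1 / (m : ℝ)

/-- The minimiser over `x` of `∑ i, u i * linComp a z x i + L/2 ‖x - z‖²`, for `u ∈ Δ_m`. -/
noncomputable def primalPoint {p m : ℕ} (L : ℝ) (a : Fin m → ℝ × EuclideanSpace ℝ (Fin p))
    (z : EuclideanSpace ℝ (Fin p)) (u : Fin m → ℝ) : EuclideanSpace ℝ (Fin p) :=
  z - (1 / L) • ∑ i, u i • (a i).2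

/-- The smoothing parameter after `k` steps, `4 G² / (L (k+1) (k+2))`. -/
noncomputable def egtMu (G L : ℝ) (k : ℕ) : ℝ :=
  4 * G ^ 2 / (L * ((k : ℝ) + 1) * ((k : ℝ) + 2))

/-- The step parameter of step `k`, `2 / (k+3)`. -/
noncomputable def egtTau (k : ℕ) : ℝ := 2 / ((k : ℝ) + 3)

/-- The maximiser over `u ∈ Δ_m` of `∑ i, u i * linComp a z x i - mu * d(u)`, where
`d(u) = log m + ∑ i, u i * log (u i)`. -/
noncomputable def smoothedDual {p m : ℕ} (mu : ℝ) (a : Fin m → ℝ × EuclideanSpace ℝ (Fin p))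
    (z x : EuclideanSpace ℝ (Fin p)) : Fin m → ℝ :=
  tilt (unifWeights m) (fun i => linComp a z x i / mu)

/-- The initial primal-dual pair. -/
noncomputable def egtInit {p m : ℕ} (G L : ℝ) (a : Fin m → ℝ × EuclideanSpace ℝ (Fin p))
    (z : EuclideanSpace ℝ (Fin p)) : EuclideanSpace ℝ (Fin p) × (Fin m → ℝ) :=
  let x := primalPoint L a z (unifWeights m)
  (x, smoothedDual (egtMu G L 0) a z x)

/-- Step `k` of the excessive gap technique, in its variant with a Bregman projection on the dual
side. -/
noncomputable def egtStep {p m : ℕ} (G L : ℝ) (a : Fin m → ℝ × EuclideanSpace ℝ (Fin p))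
    (z : EuclideanSpace ℝ (Fin p)) (k : ℕ)
    (s : EuclideanSpace ℝ (Fin p) × (Fin m → ℝ)) :
    EuclideanSpace ℝ (Fin p) × (Fin m → ℝ) :=
  let t := egtTau k
  let mu := egtMu G L k
  let v := smoothedDual mu a z s.1
  let xh := primalPoint L a z ((1 - t) • s.2 + t • v)
  let ut := tilt v (fun i => t / (1 - t) * linComp a z xh i / mu)
  ((1 - t) • s.1 + t • xh, (1 - t) • s.2 + t • ut)

/-- Run steps `k, k + 1, …, k + n - 1` of the excessive gap technique, recording each of them,
and return the primal point. -/
noncomputable def egtLoop {p m : ℕ} (G L : ℝ) (a : Fin m → ℝ × EuclideanSpace ℝ (Fin p))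
    (z : EuclideanSpace ℝ (Fin p)) :
    (n k : ℕ) → EuclideanSpace ℝ (Fin p) × (Fin m → ℝ) →
      OracleProg (Fin m) (EuclideanSpace ℝ (Fin p)) (EuclideanSpace ℝ (Fin p))
  | 0, _, s => .done s.1
  | n + 1, k, s => .tick (egtLoop G L a z n (k + 1) (egtStep G L a z k s))

/-- Number of excessive gap steps per subproblem:
`⌈4 G √(log m / (L ε̃))⌉ = ⌈2⁵ G √(log m) / ε⌉` with `ε̃ = ε² / (64 L)`. -/
noncomputable def egtSteps (m : ℕ) (G ε : ℝ) : ℕ :=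
  ⌈2 ^ 5 * G * Real.sqrt (Real.log m) / ε⌉₊

/-- The excessive gap solver for the subproblem with data `a` and centre `z`. -/
noncomputable def egtSolve {p m : ℕ} (G L ε : ℝ) (a : Fin m → ℝ × EuclideanSpace ℝ (Fin p))
    (z : EuclideanSpace ℝ (Fin p)) :
    OracleProg (Fin m) (EuclideanSpace ℝ (Fin p)) (EuclideanSpace ℝ (Fin p)) :=
  egtLoop G L a z (egtSteps m G ε) 0 (egtInit G L a z)

/-! ### Prox-FDIAG -/

open Classical in
/-- Prox-FDIAG, started in outer iteration `k` at the iterate `x` and cut off (with result `none`)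
if it has not returned within `n` further passes through the loop. A returned value `some (k, x)`
is the output `x = x_k` with its index. -/
noncomputable def proxFDIAG {p m : ℕ} (G L ε : ℝ) :
    (n k : ℕ) → EuclideanSpace ℝ (Fin p) →
      OracleProg (Fin m) (EuclideanSpace ℝ (Fin p)) (Option (ℕ × EuclideanSpace ℝ (Fin p)))
  | 0, _, _ => .done none
  | n + 1, k, x =>
      (queryAll x).bind fun a =>
        (egtSolve G L ε a x).bind fun y =>
          if (⨆ i, (a i).1) - 3 * tolParam L ε / 4 < quadModel L a x y then
            .done (some (k, x))
          else proxFDIAG G L ε n (k + 1) y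

/-- `y` solves the subproblem with centre `z` up to `ε̃/4`. -/
def IsInnerSolution {p m : ℕ} (L ε : ℝ) (f : Fin m → EuclideanSpace ℝ (Fin p) → ℝ)
    (z y : EuclideanSpace ℝ (Fin p)) : Prop :=
  ∀ w, fHat L f y z ≤ fHat L f w z + tolParam L ε / 4

/-- The stopping test of Prox-FDIAG at the iterate `z` with inner solution `y`. -/
def StopTest {p m : ℕ} (L ε : ℝ) (f : Fin m → EuclideanSpace ℝ (Fin p) → ℝ)
    (z y : EuclideanSpace ℝ (Fin p)) : Prop :=
  maxFun f z - 3 * tolParam L ε / 4 < fHat L f y z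

/-- The bound `⌈4⁴ L Δ / (3 ε²)⌉` on the number of outer steps, where `Δ = f(x₀) - f*`. -/
noncomputable def outerBound (L ε Δ : ℝ) : ℕ := ⌈4 ^ 4 * L * Δ / (3 * ε ^ 2)⌉₊

/-- The complexity bound `⌈2⁴ G (m log^{3/2} m) / ε⌉` per outer step. -/
noncomputable def innerBound (m : ℕ) (G ε : ℝ) : ℕ :=
  ⌈2 ^ 4 * G / ε * ((m : ℝ) * Real.log m ^ (3 / 2 : ℝ))⌉₊

/-! ### Smooth functions and their finite maxima -/

/-! Smoothness sandwiches the model: `maxFun f x ≤ fHat L f x z ≤ maxFun f x + L‖x - z‖²`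
(`maxFun_le_fHat`, `fHat_le_maxFun_add`). By the lower half each failed test decreases the objective
by at least 3ε̃/4, so the lower bound on `maxFun f` limits the number of failures
(`mul_le_of_forall_not_stopTest`, `exists_first_stopTest`). The upper half gives the certificate
`isEpsFOSP_of_stopTest`: at the proximal point of x the model would be far below `maxFun f x` if
that point were far from x, and a successful test excludes this. The gradient of the Moreau envelope
is 2L times the displacement to the proximal point.

The inner problem is a saddle problem, L-strongly convex in x and linear in the weights. The solver
keeps a primal-dual pair whose entropy-smoothed primal value is at most its dual value
(`ExcessiveGap`), so the true gap is at most `mu * log m` (`ExcessiveGap.quadModel_le`).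
`ExcessiveGap.egtStep` shows that a step preserves this while `mu` shrinks by the factor 1 - τ. It
rests on the exact three-point identity for exponential tilting (`sum_mul_sub_klSum_tilt`) and on
Pinsker's inequality (`sq_sum_abs_sub_le_klSum`), which controls the coupling term by G² times a
divergence. As `mu` decays like 1/N², N of order G√(log m)/ε suffices.

The counts are read off from the program semantics (`run_proxFDIAG`); the stated bounds are then
elementary numerics. -/

theorem IsLSmooth.abs_sub_linear_le {p : ℕ} {L : ℝ} {h : EuclideanSpace ℝ (Fin p) → ℝ}
    (hs : IsLSmooth L h) (x y : EuclideanSpace ℝ (Fin p)) :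
    |h y - h x - ⟪gradient h x, y - x⟫_ℝ| ≤ L / 2 * ‖y - x‖ ^ 2 := by
  set d := y - x with hd
  have hline : ∀ t : ℝ, HasDerivAt (fun t : ℝ => x + t • d) d t := fun t => by
    simpa using ((hasDerivAt_id t).smul_const d).const_add x
  have hder : ∀ t : ℝ, HasDerivAt
      (fun t : ℝ => h (x + t • d) - h x - t * ⟪gradient h x, d⟫_ℝ)
      (⟪gradient h (x + t • d) - gradient h x, d⟫_ℝ) t := by
    intro t
    have h1 := (hs.1 (x + t • d)).hasGradientAt.hasFDerivAt.comp_hasDerivAt t (hline t)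
    have h2 := (h1.sub_const (h x)).sub ((hasDerivAt_id t).mul_const ⟪gradient h x, d⟫_ℝ)
    exact h2.congr_deriv (by simp [inner_sub_left])
  have hB : ∀ t : ℝ, HasDerivAt (fun t : ℝ => L / 2 * ‖d‖ ^ 2 * t ^ 2) (L * ‖d‖ ^ 2 * t) t := by
    intro t
    exact ((hasDerivAt_pow 2 t).const_mul (L / 2 * ‖d‖ ^ 2)).congr_deriv (by ring)
  have key := image_norm_le_of_norm_deriv_right_le_deriv_boundary
    (f := fun t : ℝ => h (x + t • d) - h x - t * ⟪gradient h x, d⟫_ℝ)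
    (B := fun t : ℝ => L / 2 * ‖d‖ ^ 2 * t ^ 2) (a := 0) (b := 1)
    (fun t _ => (hder t).continuousAt.continuousWithinAt)
    (fun t _ => (hder t).hasDerivWithinAt) (by simp) hB
    (fun t ht => by
      refine (norm_inner_le_norm _ _).trans ?_
      have h3 := hs.2 (x + t • d) x
      rw [add_sub_cancel_left, norm_smul, Real.norm_of_nonneg ht.1] at h3
      nlinarith [norm_nonneg d, mul_le_mul_of_nonneg_right h3 (norm_nonneg d)])
    (Set.right_mem_Icc.2 zero_le_one)
  simpa [hd, Real.norm_eq_abs] using key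

section FiniteMax

variable {p m : ℕ} {f : Fin m → EuclideanSpace ℝ (Fin p) → ℝ}

theorem le_maxFun (f : Fin m → EuclideanSpace ℝ (Fin p) → ℝ) (i : Fin m)
    (x : EuclideanSpace ℝ (Fin p)) : f i x ≤ maxFun f x :=
  le_ciSup (f := fun i => f i x) (Set.finite_range _).bddAbove i

theorem le_fHat (L : ℝ) (f : Fin m → EuclideanSpace ℝ (Fin p) → ℝ) (i : Fin m)
    (x z : EuclideanSpace ℝ (Fin p)) :
    f i z + ⟪gradient (f i) z, x - z⟫_ℝ + L / 2 * ‖x - z‖ ^ 2 ≤ fHat L f x z :=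
  le_ciSup (f := fun i => f i z + ⟪gradient (f i) z, x - z⟫_ℝ + L / 2 * ‖x - z‖ ^ 2)
    (Set.finite_range _).bddAbove i

variable [Nonempty (Fin m)] {L : ℝ}

theorem maxFun_le_fHat (hs : ∀ i, IsLSmooth L (f i)) (x z : EuclideanSpace ℝ (Fin p)) :
    maxFun f x ≤ fHat L f x z := by
  refine ciSup_le fun i => le_trans ?_ (le_fHat L f i x z)
  linarith [(abs_le.1 ((hs i).abs_sub_linear_le z x)).2]

theorem fHat_le_maxFun_add (hs : ∀ i, IsLSmooth L (f i)) (x z : EuclideanSpace ℝ (Fin p)) :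
    fHat L f x z ≤ maxFun f x + L * ‖x - z‖ ^ 2 := by
  refine ciSup_le fun i => ?_
  linarith [(abs_le.1 ((hs i).abs_sub_linear_le z x)).1, le_maxFun f i x]

theorem continuous_maxFun (hs : ∀ i, IsLSmooth L (f i)) : Continuous (maxFun f) := by
  have : maxFun f = fun x => Finset.univ.sup' Finset.univ_nonempty (fun i => f i x) := by
    funext x
    rw [Finset.sup'_univ_eq_ciSup]; rfl
  rw [this]
  exact Continuous.finset_sup'_apply _ fun i _ => (hs i).1.continuous

end FiniteMax

/-! ### Weak convexity along segments -/

/-- `h + L/2 ‖·‖²` satisfies the convexity inequality on all segments. -/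
def SegmentWeaklyConvex {p : ℕ} (L : ℝ) (h : EuclideanSpace ℝ (Fin p) → ℝ) : Prop :=
  ∀ (x y : EuclideanSpace ℝ (Fin p)) (t : ℝ), 0 ≤ t → t ≤ 1 →
    h (x + t • (y - x)) ≤ (1 - t) * h x + t * h y + L / 2 * (t * (1 - t)) * ‖y - x‖ ^ 2

/-- Each component is bounded below at both endpoints by its expansion at the intermediate point w.
In the convex combination the gradient terms cancel, and the quadratic errors add up to t(1 - t)² +
(1 - t)t² = t(1 - t). -/
theorem segmentWeaklyConvex_maxFun {p m : ℕ} [Nonempty (Fin m)]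
    {f : Fin m → EuclideanSpace ℝ (Fin p) → ℝ} {L : ℝ} (hs : ∀ i, IsLSmooth L (f i)) :
    SegmentWeaklyConvex L (maxFun f) := by
  intro x y t ht0 ht1
  refine ciSup_le fun i => ?_
  set w := x + t • (y - x) with hw
  have hx := (abs_le.1 ((hs i).abs_sub_linear_le w x)).1
  have hy := (abs_le.1 ((hs i).abs_sub_linear_le w y)).1
  have ex : x - w = (-t) • (y - x) := by rw [hw]; module
  have ey : y - w = (1 - t) • (y - x) := by rw [hw]; module
  rw [ex, inner_smul_right, norm_smul, mul_pow, Real.norm_eq_abs, sq_abs] at hx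
  rw [ey, inner_smul_right, norm_smul, mul_pow, Real.norm_eq_abs, sq_abs] at hy
  have h1 := mul_le_mul_of_nonneg_left hx (sub_nonneg.2 ht1)
  have h2 := mul_le_mul_of_nonneg_left hy ht0
  have h3 := mul_le_mul_of_nonneg_left (le_maxFun f i x) (sub_nonneg.2 ht1)
  have h4 := mul_le_mul_of_nonneg_left (le_maxFun f i y) ht0
  linarith

theorem SegmentWeaklyConvex.isWeaklyConvex {p : ℕ} {L : ℝ} {h : EuclideanSpace ℝ (Fin p) → ℝ}
    (hc : SegmentWeaklyConvex L h) : IsWeaklyConvex L h := by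
  intro x u hu y
  rcases eq_or_ne y x with rfl | hne
  · simp
  set d := y - x with hd
  have hd0 : 0 < ‖d‖ := norm_pos_iff.2 (sub_ne_zero.2 hne)
  refine le_of_forall_pos_le_add fun δ hδ => ?_
  -- With this tolerance the subgradient inequality at x + t d loses exactly δt, so dividing the
  -- segment inequality by t and letting t → 0⁺ costs only δ.
  have hη : 0 < δ / ‖d‖ := by positivity
  have htend : Filter.Tendsto (fun t : ℝ => x + t • d) (nhdsWithin 0 (Set.Ioi 0))
      (nhdsWithin x {x}ᶜ) := by
    refine tendsto_nhdsWithin_iff.2 ⟨?_, ?_⟩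
    · have : Continuous fun t : ℝ => x + t • d := by fun_prop
      simpa using (this.tendsto 0).mono_left nhdsWithin_le_nhds
    · filter_upwards [self_mem_nhdsWithin] with t ht
      have : t • d ≠ 0 := smul_ne_zero (ne_of_gt ht) (norm_pos_iff.1 hd0)
      simpa using this
  have hev := htend.eventually (hu _ hη)
  have hlim : Filter.Tendsto (fun t : ℝ => h x + ⟪u, d⟫_ℝ - L / 2 * (1 - t) * ‖d‖ ^ 2)
      (nhdsWithin 0 (Set.Ioi 0)) (nhds (h x + ⟪u, d⟫_ℝ - L / 2 * ‖d‖ ^ 2)) := by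
    have : Continuous fun t : ℝ => h x + ⟪u, d⟫_ℝ - L / 2 * (1 - t) * ‖d‖ ^ 2 := by fun_prop
    simpa using (this.tendsto 0).mono_left nhdsWithin_le_nhds
  refine le_of_tendsto hlim ?_
  filter_upwards [hev, self_mem_nhdsWithin, nhdsWithin_le_nhds (Iio_mem_nhds one_pos)]
    with t ht ht0 ht1
  have ht0 : 0 < t := ht0
  have hseg := hc x y t ht0.le (le_of_lt ht1)
  rw [add_sub_cancel_left, inner_smul_right, norm_smul, Real.norm_of_nonneg ht0.le,
    le_div_iff₀ (by positivity)] at ht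
  have e : -(δ / ‖d‖) * (t * ‖d‖) = -(δ * t) := by field_simp
  rw [e] at ht
  rw [← hd] at hseg
  have : t * (h x + ⟪u, d⟫_ℝ - L / 2 * (1 - t) * ‖d‖ ^ 2) ≤ t * (h y + δ) := by nlinarith
  exact le_of_mul_le_mul_left this ht0

/-! ### The Moreau envelope -/

section Moreau

variable {p : ℕ} {L : ℝ} {h : EuclideanSpace ℝ (Fin p) → ℝ} {c : ℝ}

theorem exists_isMinOn_add_sq (hL : 0 < L) (hcont : Continuous h) (hb : ∀ x, c ≤ h x)
    (x : EuclideanSpace ℝ (Fin p)) :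
    ∃ z, ∀ w, h z + L * ‖x - z‖ ^ 2 ≤ h w + L * ‖x - w‖ ^ 2 := by
  have hc : Continuous fun w => h w + L * ‖x - w‖ ^ 2 := by fun_prop
  refine hc.exists_forall_le_of_isBounded x ?_
  -- On this sublevel set ‖x - w‖² ≤ (h x - c)/L; the radius (h x - c)/L + 1 avoids a square root,
  -- since r ≤ r² + 1.
  refine (Metric.isBounded_closedBall (x := x) (r := (h x - c) / L + 1)).subset fun w hw => ?_
  simp only [Set.mem_ofPred_eq, sub_self, norm_zero] at hw
  have h1 : L * ‖x - w‖ ^ 2 ≤ h x - c := by nlinarith [hb w]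
  have h2 : ‖x - w‖ ^ 2 ≤ (h x - c) / L := by rw [le_div_iff₀ hL]; linarith
  rw [Metric.mem_closedBall, dist_comm, dist_eq_norm]
  nlinarith [sq_nonneg (‖x - w‖ - 1), norm_nonneg (x - w)]

/-- Quadratic growth of the proximal objective away from its minimiser. -/
theorem SegmentWeaklyConvex.quadratic_growth (hc : SegmentWeaklyConvex L h)
    {x z : EuclideanSpace ℝ (Fin p)}
    (hz : ∀ w, h z + L * ‖x - z‖ ^ 2 ≤ h w + L * ‖x - w‖ ^ 2) (w : EuclideanSpace ℝ (Fin p)) :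
    h z + L * ‖x - z‖ ^ 2 + L / 2 * ‖w - z‖ ^ 2 ≤ h w + L * ‖x - w‖ ^ 2 := by
  -- The penalty has curvature 2L and h loses at most L, which leaves modulus L. Compare the minimum
  -- with its value at z + t(w - z), divide by t and let t → 0⁺.
  have hlim : Filter.Tendsto
      (fun t : ℝ => h z + L * ‖x - z‖ ^ 2 + L / 2 * (1 - t) * ‖w - z‖ ^ 2)
      (nhdsWithin 0 (Set.Ioi 0)) (nhds (h z + L * ‖x - z‖ ^ 2 + L / 2 * ‖w - z‖ ^ 2)) := by
    have : Continuous fun t : ℝ =>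
      h z + L * ‖x - z‖ ^ 2 + L / 2 * (1 - t) * ‖w - z‖ ^ 2 := by fun_prop
    simpa using (this.tendsto 0).mono_left nhdsWithin_le_nhds
  refine le_of_tendsto hlim ?_
  filter_upwards [self_mem_nhdsWithin, nhdsWithin_le_nhds (Iio_mem_nhds one_pos)] with t ht0 ht1
  have ht0 : 0 < t := ht0
  have hseg := hc z w t ht0.le (le_of_lt ht1)
  have hmin := hz (z + t • (w - z))
  have e1 : ‖x - (z + t • (w - z))‖ ^ 2
      = ‖x - z‖ ^ 2 - 2 * t * ⟪x - z, w - z⟫_ℝ + t ^ 2 * ‖w - z‖ ^ 2 := by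
    rw [← sub_sub, norm_sub_sq_real, inner_smul_right, norm_smul, mul_pow, Real.norm_eq_abs, sq_abs]
    ring
  have e2 : ‖x - w‖ ^ 2 = ‖x - z‖ ^ 2 - 2 * ⟪x - z, w - z⟫_ℝ + ‖w - z‖ ^ 2 := by
    rw [← norm_sub_sq_real]; congr 2; abel
  rw [e1] at hmin
  rw [e2]
  refine le_of_mul_le_mul_left ?_ ht0
  nlinarith

theorem moreauEnvelope_eq (hL : 0 < L) {x z : EuclideanSpace ℝ (Fin p)}
    (hz : ∀ w, h z + L * ‖x - z‖ ^ 2 ≤ h w + L * ‖x - w‖ ^ 2) :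
    moreauEnvelope (1 / (2 * L)) h x = h z + L * ‖x - z‖ ^ 2 := by
  have e : (1 / (2 * (1 / (2 * L)))) = L := by field_simp
  rw [moreauEnvelope, e]
  refine le_antisymm (ciInf_le ⟨h z + L * ‖x - z‖ ^ 2, ?_⟩ z) (le_ciInf hz)
  rintro _ ⟨w, rfl⟩
  exact hz w

/-- The linearisation error is at most L‖y - x‖² in absolute value. From above, z is a competitor in
the problem at y. From below, quadratic growth at z absorbs the cross term in q - z, where q is the
minimiser at y. -/
theorem SegmentWeaklyConvex.hasGradientAt_moreauEnvelope (hc : SegmentWeaklyConvex L h)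
    (hL : 0 < L) (hcont : Continuous h) (hb : ∀ x, c ≤ h x) {x z : EuclideanSpace ℝ (Fin p)}
    (hz : ∀ w, h z + L * ‖x - z‖ ^ 2 ≤ h w + L * ‖x - w‖ ^ 2) :
    HasGradientAt (moreauEnvelope (1 / (2 * L)) h) ((2 * L) • (x - z)) x := by
  rw [hasGradientAt_iff_isLittleO]
  have hO : (fun y => moreauEnvelope (1 / (2 * L)) h y - moreauEnvelope (1 / (2 * L)) h x
      - ⟪(2 * L) • (x - z), y - x⟫_ℝ) =O[nhds x] fun y => ‖y - x‖ ^ 2 := by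
    refine Asymptotics.IsBigO.of_bound L (Filter.Eventually.of_forall fun y => ?_)
    obtain ⟨q, hq⟩ := exists_isMinOn_add_sq hL hcont hb y
    rw [moreauEnvelope_eq hL hq, moreauEnvelope_eq hL hz, inner_smul_left, Real.norm_eq_abs,
      Real.norm_eq_abs, abs_of_nonneg (by positivity : (0 : ℝ) ≤ ‖y - x‖ ^ 2)]
    have expand : ∀ w, ‖y - w‖ ^ 2 = ‖x - w‖ ^ 2 + 2 * ⟪x - w, y - x⟫_ℝ + ‖y - x‖ ^ 2 := by
      intro w
      rw [← norm_add_sq_real]; congr 2; abel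
    have hup := hq z
    have hlow := hc.quadratic_growth hz q
    rw [expand z] at hup
    rw [expand q] at hup ⊢
    have hin : ⟪x - q, y - x⟫_ℝ = ⟪x - z, y - x⟫_ℝ - ⟪q - z, y - x⟫_ℝ := by
      rw [← inner_sub_left]; congr 1; abel
    have hcs := real_inner_le_norm (q - z) (y - x)
    simp only [conj_trivial]
    rw [hin] at hup ⊢
    rw [abs_le]
    constructor
    · nlinarith [sq_nonneg (‖q - z‖ - 2 * ‖y - x‖)]
    · nlinarith
  refine hO.trans_isLittleO ?_
  have : (fun y => ‖y - x‖ ^ 2) =o[nhds x] fun y => ‖y - x‖ := by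
    have h1 : Filter.Tendsto (fun y => ‖y - x‖) (nhds x) (nhds 0) := by
      have : Continuous fun y => ‖y - x‖ := by fun_prop
      simpa using this.tendsto x
    simpa [pow_two] using ((Asymptotics.isLittleO_one_iff ℝ).2 h1).mul_isBigO
      (Asymptotics.isBigO_refl (fun y => ‖y - x‖) (nhds x))
  exact this.of_norm_right

end Moreau

/-! ### The stopping test certifies approximate stationarity -/

section Certificate

variable {p m : ℕ} [Nonempty (Fin m)] {f : Fin m → EuclideanSpace ℝ (Fin p) → ℝ}
  {L ε fstar : ℝ}

theorem isEpsFOSP_of_stopTest (hL : 0 < L) (hε : 0 < ε) (hs : ∀ i, IsLSmooth L (f i))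
    (hb : ∀ x, fstar ≤ maxFun f x) {x y : EuclideanSpace ℝ (Fin p)}
    (hin : IsInnerSolution L ε f x y) (htest : StopTest L ε f x y) :
    IsEpsFOSP L ε (maxFun f) x := by
  have hc := segmentWeaklyConvex_maxFun hs
  have hcont := continuous_maxFun hs
  obtain ⟨z, hz⟩ := exists_isMinOn_add_sq hL hcont hb x
  have hgrad := hc.hasGradientAt_moreauEnvelope hL hcont hb hz
  refine ⟨hc.isWeaklyConvex, ⟨z, fun w _ => ?_⟩, hgrad.differentiableAt, ?_⟩
  · have e : (1 / (2 * (1 / (2 * L)))) = L := by field_simp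
    simpa only [e, Set.mem_ofPred_eq] using hz w
  · rw [hgrad.gradient, norm_smul, Real.norm_of_nonneg (by positivity)]
    -- With z the proximal point, `h1` to `h4` chain to f(x) - 3ε̃/4 < f(z) + L‖x - z‖² + ε̃/4 ≤
    -- f(x) - (L/2)‖x - z‖² + ε̃/4. Hence ‖2L(x - z)‖² < 8Lε̃ = ε²/8, which is more than needed.
    have h1 := hin z
    have h2 := fHat_le_maxFun_add hs z x
    have h3 := hc.quadratic_growth hz x
    have h4 : maxFun f x - 3 * tolParam L ε / 4 < fHat L f y x := htest
    rw [norm_sub_rev z x] at h2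
    simp only [sub_self, norm_zero] at h3
    have h5 : L / 2 * ‖x - z‖ ^ 2 < tolParam L ε := by nlinarith
    rw [tolParam, lt_div_iff₀ (by positivity)] at h5
    refine abs_le_of_sq_le_sq' ?_ hε.le |>.2
    nlinarith

theorem maxFun_le_of_not_stopTest (hs : ∀ i, IsLSmooth L (f i))
    {x y : EuclideanSpace ℝ (Fin p)} (htest : ¬ StopTest L ε f x y) :
    maxFun f y ≤ maxFun f x - 3 * tolParam L ε / 4 :=
  (maxFun_le_fHat hs y x).trans (not_lt.1 htest)

theorem mul_le_of_forall_not_stopTest (hs : ∀ i, IsLSmooth L (f i))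
    {x : ℕ → EuclideanSpace ℝ (Fin p)} {k : ℕ}
    (htest : ∀ j < k, ¬ StopTest L ε f (x j) (x (j + 1))) :
    k * (3 * tolParam L ε / 4) ≤ maxFun f (x 0) - maxFun f (x k) := by
  induction k with
  | zero => simp
  | succ k ih =>
    have h1 := ih fun j hj => htest j (hj.trans k.lt_succ_self)
    have h2 := maxFun_le_of_not_stopTest hs (htest k k.lt_succ_self)
    push_cast
    linarith

/-- The first successful stopping test, and its position relative to the outer bound. -/
theorem exists_first_stopTest (hL : 0 < L) (hε : 0 < ε) (hs : ∀ i, IsLSmooth L (f i))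
    (hb : ∀ x, fstar ≤ maxFun f x) (x : ℕ → EuclideanSpace ℝ (Fin p)) :
    ∃ k ≤ outerBound L ε (maxFun f (x 0) - fstar),
      StopTest L ε f (x k) (x (k + 1)) ∧ (∀ j < k, ¬ StopTest L ε f (x j) (x (j + 1))) ∧
      (fstar < maxFun f (x k) → k + 1 ≤ outerBound L ε (maxFun f (x 0) - fstar)) := by
  classical
  -- Here 3ε̃/4 = 3ε²/(4⁴L). The strict version is what later yields k + 1, rather than k, below the
  -- ceiling.
  have hconv : ∀ (k : ℕ) (Δ : ℝ), (k * (3 * tolParam L ε / 4) ≤ Δ ↔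
      (k : ℝ) ≤ 4 ^ 4 * L * Δ / (3 * ε ^ 2)) ∧ (k * (3 * tolParam L ε / 4) < Δ ↔
      (k : ℝ) < 4 ^ 4 * L * Δ / (3 * ε ^ 2)) := by
    intro k Δ
    have e : (k : ℝ) * (3 * tolParam L ε / 4) = k * (3 * ε ^ 2) / (4 ^ 4 * L) := by
      rw [tolParam]; field_simp; norm_num
    rw [e, div_le_iff₀ (by positivity), le_div_iff₀ (by positivity), div_lt_iff₀ (by positivity),
      lt_div_iff₀ (by positivity), mul_comm Δ]
    exact ⟨Iff.rfl, Iff.rfl⟩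
  have hle : ∀ k, (∀ j < k, ¬ StopTest L ε f (x j) (x (j + 1))) →
      (k : ℝ) ≤ 4 ^ 4 * L * (maxFun f (x 0) - fstar) / (3 * ε ^ 2) := fun k hk =>
    ((hconv k _).1).1 ((mul_le_of_forall_not_stopTest hs hk).trans (by linarith [hb (x k)]))
  have hex : ∃ k, StopTest L ε f (x k) (x (k + 1)) := by
    by_contra! hno
    obtain ⟨k, hk⟩ := exists_nat_gt (4 ^ 4 * L * (maxFun f (x 0) - fstar) / (3 * ε ^ 2))
    exact absurd (hle k fun j _ => hno j) (not_le.2 hk)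
  have hfirst : ∀ j < Nat.find hex, ¬ StopTest L ε f (x j) (x (j + 1)) :=
    fun j hj => Nat.find_min hex hj
  refine ⟨Nat.find hex, ?_, Nat.find_spec hex, hfirst, fun hlt => ?_⟩
  · exact Nat.cast_le.1 ((hle _ hfirst).trans (Nat.le_ceil _))
  · exact Nat.lt_ceil.2 (((hconv _ _).2).1
      ((mul_le_of_forall_not_stopTest hs hfirst).trans_lt (by linarith)))

end Certificate

/-! ### Pinsker's inequality for finite distributions -/

/-- The difference of the two sides vanishes at 1, and its derivative has the sign of (y - 1)³. This
is the scalar form of the pointwise estimate behind Pinsker's inequality. -/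
theorem log_rational_lower_bound {x : ℝ} (hx : 0 < x) :
    (5 * x ^ 2 - 4 * x - 1) / (2 * x * (x + 2)) ≤ Real.log x := by
  have hder : ∀ y : ℝ, 0 < y → HasDerivAt
      (fun y => Real.log y - (5 * y ^ 2 - 4 * y - 1) / (2 * y * (y + 2)))
      ((y - 1) ^ 3 / (y ^ 2 * (y + 2) ^ 2)) y := by
    intro y hy
    have h1 : HasDerivAt (fun y : ℝ => 5 * y ^ 2 - 4 * y - 1) (10 * y - 4) y := by
      exact ((((hasDerivAt_pow 2 y).const_mul 5).sub
        ((hasDerivAt_id y).const_mul 4)).sub_const 1).congr_deriv (by ring)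
    have h2 : HasDerivAt (fun y : ℝ => 2 * y * (y + 2)) (4 * y + 4) y := by
      exact (((hasDerivAt_id y).const_mul 2).mul
        ((hasDerivAt_id y).add_const 2)).congr_deriv (by simp; ring)
    refine ((Real.hasDerivAt_log hy.ne').sub (h1.div h2 (by positivity))).congr_deriv ?_
    field_simp
    ring
  set g : ℝ → ℝ := fun y => Real.log y - (5 * y ^ 2 - 4 * y - 1) / (2 * y * (y + 2)) with hg
  have hg1 : g 1 = 0 := by simp [hg]; norm_num
  suffices g 1 ≤ g x by rw [hg1] at this; simpa [hg] using this
  rcases le_total 1 x with h | h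
  · refine monotoneOn_of_deriv_nonneg (convex_Ici 1)
      (fun y hy => (hder y (one_pos.trans_le hy)).continuousAt.continuousWithinAt)
      (fun y hy => ?_) (fun y hy => ?_) (Set.mem_Ici.2 le_rfl) h h
    · rw [interior_Ici] at hy
      exact (hder y (one_pos.trans hy)).differentiableAt.differentiableWithinAt
    · rw [interior_Ici] at hy
      have hy1 : (0 : ℝ) ≤ y - 1 := sub_nonneg.2 (le_of_lt hy)
      rw [(hder y (one_pos.trans hy)).deriv]
      positivity
  · refine antitoneOn_of_deriv_nonpos (convex_Icc x 1)
      (fun y hy => (hder y (hx.trans_le hy.1)).continuousAt.continuousWithinAt)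
      (fun y hy => ?_) (fun y hy => ?_) (Set.left_mem_Icc.2 h) (Set.right_mem_Icc.2 h) h
    · rw [interior_Icc] at hy
      exact (hder y (hx.trans hy.1)).differentiableAt.differentiableWithinAt
    · rw [interior_Icc] at hy
      rw [(hder y (hx.trans hy.1)).deriv]
      refine div_nonpos_of_nonpos_of_nonneg ?_ (by positivity)
      exact Odd.pow_nonpos (by decide) (sub_nonpos.2 hy.2.le)

theorem three_mul_sq_sub_le {a b : ℝ} (ha : 0 ≤ a) (hb : 0 < b) :
    3 * (a - b) ^ 2 ≤ (2 * a + 4 * b) * (a * (Real.log a - Real.log b) - a + b) := by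
  rcases ha.eq_or_lt with rfl | ha
  · nlinarith [sq_nonneg b]
  · have h := log_rational_lower_bound (div_pos ha hb)
    rw [Real.log_div ha.ne' hb.ne'] at h
    have e : (5 * (a / b) ^ 2 - 4 * (a / b) - 1) / (2 * (a / b) * (a / b + 2))
        = (5 * a ^ 2 - 4 * a * b - b ^ 2) / (2 * a * (a + 2 * b)) := by field_simp
    rw [e, div_le_iff₀ (by positivity)] at h
    nlinarith

/-- The Kullback–Leibler divergence of weight vectors. -/
noncomputable def klSum {m : ℕ} (u v : Fin m → ℝ) : ℝ :=
  ∑ i, u i * (Real.log (u i) - Real.log (v i))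

theorem klSum_self {m : ℕ} (u : Fin m → ℝ) : klSum u u = 0 := by simp [klSum]

/-- Cauchy–Schwarz applied to the pointwise bound `three_mul_sq_sub_le`: the factors (2u + 4v)/3 sum
to 2, and the terms -u + v sum to zero. -/
theorem sq_sum_abs_sub_le_klSum {m : ℕ} {u v : Fin m → ℝ} (hu : u ∈ stdSimplex ℝ (Fin m))
    (hv : v ∈ stdSimplex ℝ (Fin m)) (hv0 : ∀ i, 0 < v i) :
    (∑ i, |u i - v i|) ^ 2 ≤ 2 * klSum u v := by
  have hpos : ∀ i, 0 ≤ u i * (Real.log (u i) - Real.log (v i)) - u i + v i := by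
    intro i
    have h := three_mul_sq_sub_le (hu.1 i) (hv0 i)
    have h0 : 0 < 2 * u i + 4 * v i := by linarith [hu.1 i, hv0 i]
    exact nonneg_of_mul_nonneg_right ((by positivity : (0 : ℝ) ≤ 3 * (u i - v i) ^ 2).trans h) h0
  have h := Finset.sum_sq_le_sum_mul_sum_of_sq_le_mul Finset.univ (r := fun i => |u i - v i|)
    (f := fun i => (2 * u i + 4 * v i) / 3)
    (g := fun i => u i * (Real.log (u i) - Real.log (v i)) - u i + v i)
    (fun i _ => by linarith [hu.1 i, hv0 i]) (fun i _ => hpos i)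
    (fun i _ => by rw [sq_abs]; linarith [three_mul_sq_sub_le (hu.1 i) (hv0 i)])
  rw [← Finset.sum_div, Finset.sum_add_distrib, ← Finset.mul_sum, ← Finset.mul_sum, hu.2, hv.2,
    Finset.sum_add_distrib, Finset.sum_sub_distrib, hu.2, hv.2] at h
  refine h.trans (le_of_eq ?_)
  rw [klSum]; ring

theorem klSum_nonneg {m : ℕ} {u v : Fin m → ℝ} (hu : u ∈ stdSimplex ℝ (Fin m))
    (hv : v ∈ stdSimplex ℝ (Fin m)) (hv0 : ∀ i, 0 < v i) : 0 ≤ klSum u v := by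
  linarith [sq_sum_abs_sub_le_klSum hu hv hv0, sq_nonneg (∑ i, |u i - v i|)]

theorem norm_sq_sum_sub_smul_le {m : ℕ} {F : Type*} [NormedAddCommGroup F] [NormedSpace ℝ F]
    {u v : Fin m → ℝ} (hu : u ∈ stdSimplex ℝ (Fin m)) (hv : v ∈ stdSimplex ℝ (Fin m))
    (hv0 : ∀ i, 0 < v i) {g : Fin m → F} {G : ℝ} (hg : ∀ i, ‖g i‖ ≤ G) :
    ‖∑ i, (u i - v i) • g i‖ ^ 2 ≤ 2 * G ^ 2 * klSum u v := by
  have h1 : ‖∑ i, (u i - v i) • g i‖ ≤ G * ∑ i, |u i - v i| := by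
    rw [Finset.mul_sum]
    refine norm_sum_le_of_le _ fun i _ => ?_
    rw [norm_smul, Real.norm_eq_abs, mul_comm]
    gcongr
    exact hg i
  calc ‖∑ i, (u i - v i) • g i‖ ^ 2 ≤ (G * ∑ i, |u i - v i|) ^ 2 := by gcongr
    _ = G ^ 2 * (∑ i, |u i - v i|) ^ 2 := by ring
    _ ≤ G ^ 2 * (2 * klSum u v) := by gcongr; exact sq_sum_abs_sub_le_klSum hu hv hv0
    _ = _ := by ring

/-! ### Exponential tilting -/

section Tilt

variable {m : ℕ}

theorem unifWeights_pos (i : Fin m) : 0 < unifWeights m i := by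
  have : 0 < m := Fin.pos i
  simp only [unifWeights]
  positivity

theorem klSum_single_unifWeights (i : Fin m) :
    klSum (Pi.single i 1) (unifWeights m) = Real.log m := by
  rw [klSum, Finset.sum_eq_single i]
  · simp [unifWeights]
  · intro j _ hj
    simp [hj]
  · simp

variable [Nonempty (Fin m)]

theorem tilt_sum_pos {v : Fin m → ℝ} (hv : ∀ i, 0 < v i) (s : Fin m → ℝ) :
    0 < ∑ j, v j * Real.exp (s j) :=
  Finset.sum_pos (fun j _ => mul_pos (hv j) (Real.exp_pos _)) Finset.univ_nonempty

theorem tilt_pos {v : Fin m → ℝ} (hv : ∀ i, 0 < v i) (s : Fin m → ℝ) (i : Fin m) :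
    0 < tilt v s i :=
  div_pos (mul_pos (hv i) (Real.exp_pos _)) (tilt_sum_pos hv s)

theorem tilt_mem_stdSimplex {v : Fin m → ℝ} (hv : ∀ i, 0 < v i) (s : Fin m → ℝ) :
    tilt v s ∈ stdSimplex ℝ (Fin m) := by
  refine ⟨fun i => (tilt_pos hv s i).le, ?_⟩
  simp only [tilt]
  rw [← Finset.sum_div, div_self (tilt_sum_pos hv s).ne']

/-- The Gibbs variational identity. -/
theorem sum_mul_sub_klSum_eq {v : Fin m → ℝ} (hv : ∀ i, 0 < v i) (s : Fin m → ℝ)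
    {w : Fin m → ℝ} (hw : w ∈ stdSimplex ℝ (Fin m)) :
    ∑ i, w i * s i - klSum w v
      = Real.log (∑ j, v j * Real.exp (s j)) - klSum w (tilt v s) := by
  have hlog : ∀ i, Real.log (tilt v s i)
      = Real.log (v i) + s i - Real.log (∑ j, v j * Real.exp (s j)) := by
    intro i
    rw [tilt, Real.log_div (mul_pos (hv i) (Real.exp_pos _)).ne' (tilt_sum_pos hv s).ne',
      Real.log_mul (hv i).ne' (Real.exp_pos _).ne', Real.log_exp]
  have hconst : Real.log (∑ j, v j * Real.exp (s j))
      = ∑ i, w i * Real.log (∑ j, v j * Real.exp (s j)) := by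
    rw [← Finset.sum_mul, hw.2, one_mul]
  simp only [klSum, hlog]
  nth_rw 1 [hconst]
  rw [← Finset.sum_sub_distrib, ← Finset.sum_sub_distrib]
  exact Finset.sum_congr rfl fun i _ => by ring

theorem sum_mul_sub_klSum_tilt {v : Fin m → ℝ} (hv : ∀ i, 0 < v i) (s : Fin m → ℝ)
    {w : Fin m → ℝ} (hw : w ∈ stdSimplex ℝ (Fin m)) :
    ∑ i, w i * s i - klSum w v
      = ∑ i, tilt v s i * s i - klSum (tilt v s) v - klSum w (tilt v s) := by
  rw [sum_mul_sub_klSum_eq hv s hw, sum_mul_sub_klSum_eq hv s (tilt_mem_stdSimplex hv s),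
    klSum_self, sub_zero]

theorem unifWeights_mem_stdSimplex : unifWeights m ∈ stdSimplex ℝ (Fin m) := by
  have : 0 < m := Fin.pos (Classical.arbitrary (Fin m))
  refine ⟨fun i => (unifWeights_pos i).le, ?_⟩
  simp only [unifWeights, Finset.sum_const, Finset.card_univ, Fintype.card_fin, nsmul_eq_mul]
  field_simp

end Tilt

/-! ### The saddle function of the model -/

section Saddle

variable {p m : ℕ} {L : ℝ} {a : Fin m → ℝ × EuclideanSpace ℝ (Fin p)}
  {z : EuclideanSpace ℝ (Fin p)}

/-- `∑ i, u i * linComp a z x i + L/2 ‖x - z‖²`. -/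
noncomputable def saddleFun (L : ℝ) (a : Fin m → ℝ × EuclideanSpace ℝ (Fin p))
    (z x : EuclideanSpace ℝ (Fin p)) (u : Fin m → ℝ) : ℝ :=
  ∑ i, u i * linComp a z x i + L / 2 * ‖x - z‖ ^ 2

/-- The dual function `min_x saddleFun L a z x u`. -/
noncomputable def dualFun (L : ℝ) (a : Fin m → ℝ × EuclideanSpace ℝ (Fin p))
    (u : Fin m → ℝ) : ℝ :=
  ∑ i, u i * (a i).1 - 1 / (2 * L) * ‖∑ i, u i • (a i).2‖ ^ 2

theorem sum_mul_linComp (x : EuclideanSpace ℝ (Fin p)) (u : Fin m → ℝ) :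
    ∑ i, u i * linComp a z x i = ∑ i, u i * (a i).1 + ⟪∑ i, u i • (a i).2, x - z⟫_ℝ := by
  simp only [linComp, sum_inner, inner_smul_left, conj_trivial, mul_add, Finset.sum_add_distrib]

/-- Completing the square in x. -/
theorem saddleFun_eq_dualFun_add (hL : 0 < L) (x : EuclideanSpace ℝ (Fin p)) (u : Fin m → ℝ) :
    saddleFun L a z x u = dualFun L a u + L / 2 * ‖(x - z) + (1 / L) • ∑ i, u i • (a i).2‖ ^ 2 := by
  rw [saddleFun, dualFun, sum_mul_linComp, norm_add_sq_real, inner_smul_right, norm_smul, mul_pow,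
    Real.norm_eq_abs, sq_abs, real_inner_comm]
  field_simp
  ring

theorem dualFun_le_saddleFun (hL : 0 < L) (x : EuclideanSpace ℝ (Fin p)) (u : Fin m → ℝ) :
    dualFun L a u ≤ saddleFun L a z x u := by
  rw [saddleFun_eq_dualFun_add hL]
  have : 0 ≤ L / 2 * ‖(x - z) + (1 / L) • ∑ i, u i • (a i).2‖ ^ 2 := by positivity
  linarith

theorem saddleFun_primalPoint (hL : 0 < L) (u v : Fin m → ℝ) :
    saddleFun L a z (primalPoint L a z v) u
      = dualFun L a u + 1 / (2 * L) * ‖∑ i, (u i - v i) • (a i).2‖ ^ 2 := by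
  rw [saddleFun_eq_dualFun_add hL]
  have e : primalPoint L a z v - z + (1 / L) • ∑ i, u i • (a i).2
      = (1 / L) • ∑ i, (u i - v i) • (a i).2 := by
    simp only [primalPoint, sub_smul, Finset.sum_sub_distrib, smul_sub]
    abel
  rw [e, norm_smul, mul_pow, Real.norm_eq_abs, sq_abs]
  field_simp

theorem saddleFun_combine_right (x : EuclideanSpace ℝ (Fin p)) (u v : Fin m → ℝ) (t : ℝ) :
    saddleFun L a z x ((1 - t) • u + t • v)
      = (1 - t) * saddleFun L a z x u + t * saddleFun L a z x v := by
  have : ∑ i, ((1 - t) • u + t • v) i * linComp a z x i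
      = (1 - t) * ∑ i, u i * linComp a z x i + t * ∑ i, v i * linComp a z x i := by
    rw [Finset.mul_sum, Finset.mul_sum, ← Finset.sum_add_distrib]
    exact Finset.sum_congr rfl fun i _ => by simp; ring
  rw [saddleFun, saddleFun, saddleFun, this]
  ring

theorem saddleFun_combine_left_le (hL : 0 ≤ L) (x y : EuclideanSpace ℝ (Fin p)) (u : Fin m → ℝ)
    {t : ℝ} (ht0 : 0 ≤ t) (ht1 : t ≤ 1) :
    saddleFun L a z ((1 - t) • x + t • y) u
      ≤ (1 - t) * saddleFun L a z x u + t * saddleFun L a z y u := by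
  have e : (1 - t) • x + t • y - z = (1 - t) • (x - z) + t • (y - z) := by module
  simp only [saddleFun, sum_mul_linComp]
  rw [e, inner_add_right, inner_smul_right, inner_smul_right]
  have h : ‖(1 - t) • (x - z) + t • (y - z)‖ ^ 2
      ≤ (1 - t) * ‖x - z‖ ^ 2 + t * ‖y - z‖ ^ 2 := by
    rw [norm_add_sq_real, norm_smul, norm_smul, inner_smul_left, inner_smul_right,
      Real.norm_of_nonneg ht0, Real.norm_of_nonneg (sub_nonneg.2 ht1)]
    have h1 : 0 ≤ (1 - t) * t * ‖(x - z) - (y - z)‖ ^ 2 :=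
      mul_nonneg (mul_nonneg (sub_nonneg.2 ht1) ht0) (sq_nonneg _)
    rw [norm_sub_sq_real] at h1
    simp only [conj_trivial]
    nlinarith
  nlinarith [mul_le_mul_of_nonneg_left h (by positivity : 0 ≤ L / 2)]

theorem saddleFun_le_quadModel (x : EuclideanSpace ℝ (Fin p)) {u : Fin m → ℝ}
    (hu : u ∈ stdSimplex ℝ (Fin m)) : saddleFun L a z x u ≤ quadModel L a z x := by
  have h : ∀ i, linComp a z x i + L / 2 * ‖x - z‖ ^ 2 ≤ quadModel L a z x := fun i =>
    le_ciSup (f := fun i => linComp a z x i + L / 2 * ‖x - z‖ ^ 2) (Set.finite_range _).bddAbove i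
  calc saddleFun L a z x u = ∑ i, u i * (linComp a z x i + L / 2 * ‖x - z‖ ^ 2) := by
        simp only [saddleFun, mul_add, Finset.sum_add_distrib, ← Finset.sum_mul, hu.2, one_mul]
    _ ≤ ∑ i, u i * quadModel L a z x := by
        gcongr with i
        · exact hu.1 i
        · exact h i
    _ = quadModel L a z x := by rw [← Finset.sum_mul, hu.2, one_mul]

variable [Nonempty (Fin m)]

/-! ### The excessive gap invariant -/

/-- The excessive gap condition with smoothing parameter `mu`. -/
def ExcessiveGap (L mu : ℝ) (a : Fin m → ℝ × EuclideanSpace ℝ (Fin p))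
    (z : EuclideanSpace ℝ (Fin p)) (s : EuclideanSpace ℝ (Fin p) × (Fin m → ℝ)) : Prop :=
  s.2 ∈ stdSimplex ℝ (Fin m) ∧ ∀ w ∈ stdSimplex ℝ (Fin m),
    saddleFun L a z s.1 w - mu * klSum w (unifWeights m) ≤ dualFun L a s.2

theorem ExcessiveGap.quadModel_le (hL : 0 < L) {mu : ℝ}
    {s : EuclideanSpace ℝ (Fin p) × (Fin m → ℝ)} (hs : ExcessiveGap L mu a z s)
    (y : EuclideanSpace ℝ (Fin p)) :
    quadModel L a z s.1 ≤ quadModel L a z y + mu * Real.log m := by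
  refine ciSup_le fun i => ?_
  -- The vertices of the simplex recover the individual components, at the price of divergence log m
  -- from the uniform weights.
  have h := hs.2 _ (single_mem_stdSimplex ℝ i)
  rw [klSum_single_unifWeights] at h
  have e : saddleFun L a z s.1 (Pi.single i 1) = linComp a z s.1 i + L / 2 * ‖s.1 - z‖ ^ 2 := by
    simp [saddleFun, Pi.single_apply]
  rw [e] at h
  linarith [dualFun_le_saddleFun (a := a) (z := z) hL y s.2,
    saddleFun_le_quadModel (L := L) (a := a) (z := z) y hs.1]

theorem saddleFun_sub_smoothedDual {mu : ℝ} (hmu : 0 < mu) (x : EuclideanSpace ℝ (Fin p))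
    {w : Fin m → ℝ} (hw : w ∈ stdSimplex ℝ (Fin m)) :
    saddleFun L a z x w - mu * klSum w (unifWeights m)
      = saddleFun L a z x (smoothedDual mu a z x)
        - mu * klSum (smoothedDual mu a z x) (unifWeights m)
        - mu * klSum w (smoothedDual mu a z x) := by
  have h := sum_mul_sub_klSum_tilt unifWeights_pos (fun i => linComp a z x i / mu) hw
  have e : ∀ u : Fin m → ℝ,
      ∑ i, u i * linComp a z x i = mu * ∑ i, u i * (linComp a z x i / mu) := by
    intro u
    rw [Finset.mul_sum]
    exact Finset.sum_congr rfl fun i _ => by field_simp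
  simp only [saddleFun, smoothedDual, e w, e (tilt _ _)]
  linear_combination mu * h

variable {G : ℝ}

theorem excessiveGap_egtInit (hL : 0 < L) (hG : 0 < G) (ha : ∀ i, ‖(a i).2‖ ≤ G) :
    ExcessiveGap L (egtMu G L 0) a z (egtInit G L a z) := by
  have hmu : egtMu G L 0 = 2 * G ^ 2 / L := by
    rw [egtMu]; field_simp; norm_num
  have hmu0 : 0 < egtMu G L 0 := by rw [hmu]; positivity
  set x := primalPoint L a z (unifWeights m) with hx
  have hmem : smoothedDual (egtMu G L 0) a z x ∈ stdSimplex ℝ (Fin m) :=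
    tilt_mem_stdSimplex unifWeights_pos _
  have hpos : ∀ i, 0 < smoothedDual (egtMu G L 0) a z x i := tilt_pos unifWeights_pos _
  refine ⟨hmem, fun w hw => ?_⟩
  change saddleFun L a z x w - _ ≤ dualFun L a (smoothedDual (egtMu G L 0) a z x)
  rw [saddleFun_sub_smoothedDual hmu0 x hw]
  have h1 := saddleFun_primalPoint (a := a) (z := z) hL (smoothedDual (egtMu G L 0) a z x)
    (unifWeights m)
  rw [← hx] at h1
  have h2 := norm_sq_sum_sub_smul_le hmem unifWeights_mem_stdSimplex unifWeights_pos ha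
  have h3 := mul_nonneg hmu0.le (klSum_nonneg hw hmem hpos)
  have h4 : 1 / (2 * L) * ‖∑ i, (smoothedDual (egtMu G L 0) a z x i - unifWeights m i) • (a i).2‖ ^ 2
      ≤ egtMu G L 0 * klSum (smoothedDual (egtMu G L 0) a z x) (unifWeights m) := by
    have hk := klSum_nonneg hmem unifWeights_mem_stdSimplex unifWeights_pos
    calc _ ≤ 1 / (2 * L) * (2 * G ^ 2 *
          klSum (smoothedDual (egtMu G L 0) a z x) (unifWeights m)) := by gcongr
      _ = G ^ 2 / L * klSum (smoothedDual (egtMu G L 0) a z x) (unifWeights m) := by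
          field_simp
      _ ≤ _ := by
          gcongr
          rw [hmu]
          gcongr
          nlinarith [sq_nonneg G]
  linarith

/-- The old invariant at v gives `hold`, and optimality of `ut` gives `hbreg`. Weighted by 1 - t and
1, they bound the new smoothed primal value by the saddle value at (xh, new weights) minus (1 -
t)·mu·KL(ut, v). That saddle value exceeds the new dual value only by a quadratic term in t(ut - v),
which the divergence pays for. -/
theorem ExcessiveGap.egtStep (hL : 0 < L) (hG : 0 < G) (ha : ∀ i, ‖(a i).2‖ ≤ G) {k : ℕ}
    {s : EuclideanSpace ℝ (Fin p) × (Fin m → ℝ)} (hs : ExcessiveGap L (egtMu G L k) a z s) :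
    ExcessiveGap L (egtMu G L (k + 1)) a z (egtStep G L a z k s) := by
  obtain ⟨hu, hgap⟩ := hs
  set t := egtTau k with ht
  set mu := egtMu G L k with hmu
  have ht0 : 0 < t := by rw [ht, egtTau]; positivity
  have ht1 : t < 1 := by
    rw [ht, egtTau, div_lt_one (by positivity)]
    have : (0 : ℝ) ≤ k := k.cast_nonneg
    linarith
  have ht1' : 0 < 1 - t := sub_pos.2 ht1
  have hmu0 : 0 < mu := by rw [hmu, egtMu]; positivity
  have hmu' : egtMu G L (k + 1) = (1 - t) * mu := by
    rw [ht, hmu, egtMu, egtMu, egtTau]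
    push_cast
    field_simp
    ring
  -- After cancellation this is k + 2 ≤ k + 3; it is the condition tying the step parameters to the
  -- smoothing parameters.
  have hstep : t ^ 2 * G ^ 2 / L ≤ (1 - t) * mu := by
    rw [← hmu', ht, egtTau, egtMu]
    push_cast
    rw [div_pow, div_mul_eq_mul_div, div_div, div_le_div_iff₀ (by positivity) (by positivity)]
    have : (0 : ℝ) ≤ k := k.cast_nonneg
    have h1 : 0 ≤ G ^ 2 * L * ((k : ℝ) + 3) := by positivity
    nlinarith
  set v := smoothedDual mu a z s.1 with hv
  set uh := (1 - t) • s.2 + t • v with huh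
  set xh := primalPoint L a z uh with hxh
  set r : Fin m → ℝ := fun i => t / (1 - t) * linComp a z xh i / mu with hr
  set ut := tilt v r with hut
  have hvpos : ∀ i, 0 < v i := tilt_pos unifWeights_pos _
  have hvmem : v ∈ stdSimplex ℝ (Fin m) := tilt_mem_stdSimplex unifWeights_pos _
  have hutmem : ut ∈ stdSimplex ℝ (Fin m) := tilt_mem_stdSimplex hvpos _
  have hutpos : ∀ i, 0 < ut i := tilt_pos hvpos _
  have hmem : (1 - t) • s.2 + t • ut ∈ stdSimplex ℝ (Fin m) :=
    convex_stdSimplex ℝ (Fin m) hu hutmem ht1'.le ht0.le (by ring)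
  refine ⟨hmem, fun w hw => ?_⟩
  change saddleFun L a z ((1 - t) • s.1 + t • xh) w - _ ≤ dualFun L a ((1 - t) • s.2 + t • ut)
  rw [hmu']
  have hprimal := saddleFun_combine_left_le (a := a) (z := z) hL.le s.1 xh w ht0.le ht1.le
  have hold : saddleFun L a z s.1 w - mu * klSum w (unifWeights m)
      ≤ saddleFun L a z xh s.2 - mu * klSum w v := by
    have h1 := saddleFun_sub_smoothedDual (L := L) (a := a) (z := z) hmu0 s.1 hw
    have h2 := hgap v hvmem
    rw [← hv] at h1
    linarith [dualFun_le_saddleFun (a := a) (z := z) hL xh s.2]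
  have hbreg : t * saddleFun L a z xh w - (1 - t) * mu * klSum w v
      ≤ t * saddleFun L a z xh ut - (1 - t) * mu * klSum ut v := by
    have h1 := sum_mul_sub_klSum_tilt hvpos r hw
    rw [← hut] at h1
    have h2 := klSum_nonneg hw hutmem hutpos
    have e : ∀ u : Fin m → ℝ,
        t * ∑ i, u i * linComp a z xh i = (1 - t) * mu * ∑ i, u i * r i := by
      intro u
      rw [Finset.mul_sum, Finset.mul_sum]
      exact Finset.sum_congr rfl fun i _ => by simp only [hr]; field_simp
    have h3 := e w
    have h4 := e ut
    have h5 : 0 ≤ (1 - t) * mu * klSum w ut := by positivity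
    simp only [saddleFun]
    have h6 := congrArg (fun y => (1 - t) * mu * y) h1
    simp only [mul_sub] at h6
    nlinarith
  have hdual := saddleFun_primalPoint (a := a) (z := z) hL ((1 - t) • s.2 + t • ut) uh
  rw [← hxh, saddleFun_combine_right] at hdual
  have hdiff : ‖∑ i, (((1 - t) • s.2 + t • ut) i - uh i) • (a i).2‖ ^ 2
      = t ^ 2 * ‖∑ i, (ut i - v i) • (a i).2‖ ^ 2 := by
    have : ∑ i, (((1 - t) • s.2 + t • ut) i - uh i) • (a i).2
        = t • ∑ i, (ut i - v i) • (a i).2 := by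
      rw [Finset.smul_sum]
      refine Finset.sum_congr rfl fun i _ => ?_
      rw [smul_smul]
      congr 1
      simp [huh]; ring
    rw [this, norm_smul, mul_pow, Real.norm_eq_abs, sq_abs]
  rw [hdiff] at hdual
  have hpin := norm_sq_sum_sub_smul_le hutmem hvmem hvpos ha
  have hk := klSum_nonneg hutmem hvmem hvpos
  have hquad : 1 / (2 * L) * (t ^ 2 * ‖∑ i, (ut i - v i) • (a i).2‖ ^ 2)
      ≤ (1 - t) * mu * klSum ut v := by
    calc _ ≤ 1 / (2 * L) * (t ^ 2 * (2 * G ^ 2 * klSum ut v)) := by gcongr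
      _ = t ^ 2 * G ^ 2 / L * klSum ut v := by field_simp
      _ ≤ _ := by gcongr
  nlinarith [mul_le_mul_of_nonneg_left hold ht1'.le]

end Saddle

/-! ### Running oracle programs -/

namespace OracleProg

variable {ι E α β : Type}

theorem run_bind (O : ι → E → ℝ × E) (q : OracleProg ι E α) (k : α → OracleProg ι E β) :
    (q.bind k).run O = ⟨((k (q.run O).value).run O).value,
      (q.run O).queries + ((k (q.run O).value).run O).queries,
      (q.run O).innerSteps + ((k (q.run O).value).run O).innerSteps⟩ := by
  induction q with
  | done a => simp [bind, run]
  | query i x next ih => simp [bind, run, ih, add_right_comm]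
  | tick next ih => simp [bind, run, ih, add_right_comm]

theorem run_queryList [DecidableEq ι] (O : ι → E → ℝ × E) (x : E) (l : List ι)
    (acc : ι → ℝ × E) :
    (queryList x l acc).run O = ⟨fun i => if i ∈ l then O i x else acc i, l.length, 0⟩ := by
  induction l generalizing acc with
  | nil => simp [queryList, run]
  | cons j l ih =>
    simp only [queryList, run, ih, List.length_cons, RunResult.mk.injEq, and_self, and_true]
    funext i
    by_cases hij : i = j
    · subst hij; simp
    · simp [hij]

end OracleProg

section Runs

variable {p m : ℕ}

theorem run_queryAll (O : Fin m → EuclideanSpace ℝ (Fin p) → ℝ × EuclideanSpace ℝ (Fin p))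
    (x : EuclideanSpace ℝ (Fin p)) :
    (queryAll x).run O = ⟨fun i => O i x, m, 0⟩ := by
  simp [queryAll, OracleProg.run_queryList]

/-- The primal-dual pair after the excessive gap steps `k, …, k + n - 1`. -/
noncomputable def egtIter (G L : ℝ) (a : Fin m → ℝ × EuclideanSpace ℝ (Fin p))
    (z : EuclideanSpace ℝ (Fin p)) :
    (n k : ℕ) → EuclideanSpace ℝ (Fin p) × (Fin m → ℝ) → EuclideanSpace ℝ (Fin p) × (Fin m → ℝ)
  | 0, _, s => s
  | n + 1, k, s => egtIter G L a z n (k + 1) (egtStep G L a z k s)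

theorem run_egtLoop (O : Fin m → EuclideanSpace ℝ (Fin p) → ℝ × EuclideanSpace ℝ (Fin p))
    (G L : ℝ) (a : Fin m → ℝ × EuclideanSpace ℝ (Fin p)) (z : EuclideanSpace ℝ (Fin p))
    (n k : ℕ) (s : EuclideanSpace ℝ (Fin p) × (Fin m → ℝ)) :
    (egtLoop G L a z n k s).run O = ⟨(egtIter G L a z n k s).1, 0, n⟩ := by
  induction n generalizing k s with
  | zero => simp [egtLoop, egtIter, OracleProg.run]
  | succ n ih => simp [egtLoop, egtIter, OracleProg.run, ih]

/-- The point returned by the excessive gap solver. -/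
noncomputable def egtOutput (G L ε : ℝ) (a : Fin m → ℝ × EuclideanSpace ℝ (Fin p))
    (z : EuclideanSpace ℝ (Fin p)) : EuclideanSpace ℝ (Fin p) :=
  (egtIter G L a z (egtSteps m G ε) 0 (egtInit G L a z)).1

theorem run_egtSolve (O : Fin m → EuclideanSpace ℝ (Fin p) → ℝ × EuclideanSpace ℝ (Fin p))
    (G L ε : ℝ) (a : Fin m → ℝ × EuclideanSpace ℝ (Fin p)) (z : EuclideanSpace ℝ (Fin p)) :
    (egtSolve G L ε a z).run O = ⟨egtOutput G L ε a z, 0, egtSteps m G ε⟩ :=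
  run_egtLoop O G L a z _ _ _

/-- Here d counts the failed tests still to come. Any cutoff above d gives the same run, so the
cutoff does not affect the result; the final test accounts for the extra 1 in d + 1. -/
theorem run_proxFDIAG (f : Fin m → EuclideanSpace ℝ (Fin p) → ℝ) (G L ε : ℝ)
    {x : ℕ → EuclideanSpace ℝ (Fin p)}
    (hx : ∀ k, x (k + 1) = egtOutput G L ε (fun i => firstOrderOracle f i (x k)) (x k))
    {k : ℕ} (htest : StopTest L ε f (x k) (x (k + 1)))
    (hfirst : ∀ j < k, ¬ StopTest L ε f (x j) (x (j + 1)))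
    {i d n : ℕ} (hi : i + d = k) (hn : d < n) :
    (proxFDIAG G L ε n i (x i)).run (firstOrderOracle f)
      = ⟨some (k, x k), (d + 1) * m, (d + 1) * egtSteps m G ε⟩ := by
  induction d generalizing i n with
  | zero =>
    obtain ⟨n, rfl⟩ := Nat.exists_eq_succ_of_ne_zero hn.ne'
    obtain rfl : i = k := hi
    have h : (⨆ j, (firstOrderOracle f j (x i)).1) - 3 * tolParam L ε / 4
        < quadModel L (fun j => firstOrderOracle f j (x i)) (x i) (x (i + 1)) := htest
    simp [proxFDIAG, OracleProg.run_bind, run_queryAll, run_egtSolve, ← hx, h, OracleProg.run]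
  | succ d ih =>
    obtain ⟨n, rfl⟩ := Nat.exists_eq_succ_of_ne_zero (Nat.ne_zero_of_lt hn)
    have h : ¬ (⨆ j, (firstOrderOracle f j (x i)).1) - 3 * tolParam L ε / 4
        < quadModel L (fun j => firstOrderOracle f j (x i)) (x i) (x (i + 1)) :=
      hfirst i (by omega)
    have h' := ih (i := i + 1) (n := n) (by omega) (by omega)
    simp only [proxFDIAG, OracleProg.run_bind, run_queryAll, run_egtSolve, ← hx, h, if_false, h',
      RunResult.mk.injEq, true_and]
    constructor <;> ring

end Runs

/-! ### Accuracy of the excessive gap solver -/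

section Accuracy

variable {p m : ℕ} {G L ε : ℝ} {a : Fin m → ℝ × EuclideanSpace ℝ (Fin p)}
  {z : EuclideanSpace ℝ (Fin p)}

theorem ExcessiveGap.egtIter [Nonempty (Fin m)] (hL : 0 < L) (hG : 0 < G)
    (ha : ∀ i, ‖(a i).2‖ ≤ G) (n : ℕ) {k : ℕ} {s : EuclideanSpace ℝ (Fin p) × (Fin m → ℝ)}
    (hs : ExcessiveGap L (egtMu G L k) a z s) :
    ExcessiveGap L (egtMu G L (k + n)) a z (egtIter G L a z n k s) := by
  induction n generalizing k s with
  | zero => exact hs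
  | succ n ih =>
    have := ih (hs.egtStep hL hG ha)
    rwa [add_right_comm, add_assoc] at this

theorem egtMu_egtSteps_mul_log_le (hL : 0 < L) (hG : 0 < G) (hε : 0 < ε) :
    egtMu G L (egtSteps m G ε) * Real.log m ≤ tolParam L ε / 4 := by
  have hlog : 0 ≤ Real.log m := Real.log_natCast_nonneg m
  set N : ℝ := (egtSteps m G ε : ℝ) with hN
  have hN0 : 0 ≤ N := Nat.cast_nonneg _
  have h1 : 2 ^ 5 * G * Real.sqrt (Real.log m) / ε ≤ N := Nat.le_ceil _
  rw [div_le_iff₀ hε] at h1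
  have h2 : (2 ^ 5 * G * Real.sqrt (Real.log m)) ^ 2 ≤ (N * ε) ^ 2 := by gcongr
  rw [mul_pow, Real.sq_sqrt hlog] at h2
  rw [egtMu, tolParam, div_mul_eq_mul_div, div_div, div_le_div_iff₀ (by positivity) (by positivity)]
  have h3 : (N * ε) ^ 2 ≤ ε ^ 2 * ((N + 1) * (N + 2)) := by
    nlinarith [mul_nonneg hN0 (sq_nonneg ε), sq_nonneg ε]
  nlinarith [h2.trans h3]

theorem quadModel_egtOutput_le [Nonempty (Fin m)] (hL : 0 < L) (hG : 0 ≤ G) (hε : 0 < ε)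
    (ha : ∀ i, ‖(a i).2‖ ≤ G) (y : EuclideanSpace ℝ (Fin p)) :
    quadModel L a z (egtOutput G L ε a z) ≤ quadModel L a z y + tolParam L ε / 4 := by
  rcases hG.eq_or_lt with rfl | hG
  -- For G = 0 the smoothing parameters vanish and the invariant is unavailable, but no steps are
  -- run and the initial primal point z minimises the model exactly.
  · have h0 : ∀ i, (a i).2 = 0 := fun i => norm_le_zero_iff.1 (ha i)
    have hsteps : egtSteps m 0 ε = 0 := by simp [egtSteps]
    have hout : egtOutput 0 L ε a z = z := by
      rw [egtOutput, hsteps]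
      simp [egtIter, egtInit, primalPoint, h0]
    have htol : 0 < tolParam L ε := by rw [tolParam]; positivity
    have hmono : quadModel L a z z ≤ quadModel L a z y := by
      refine ciSup_mono (Set.finite_range _).bddAbove fun i => ?_
      simp only [linComp, h0, inner_zero_left, sub_self, norm_zero]
      have : 0 ≤ L / 2 * ‖y - z‖ ^ 2 := by positivity
      linarith
    rw [hout]
    linarith
  · have h1 := (excessiveGap_egtInit (z := z) hL hG ha).egtIter hL hG ha (egtSteps m G ε)
    rw [zero_add] at h1
    exact (h1.quadModel_le hL y).trans (by
      linarith [egtMu_egtSteps_mul_log_le (m := m) hL hG hε])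

theorem LipschitzWith.norm_gradient_le {C : NNReal} {h : EuclideanSpace ℝ (Fin p) → ℝ}
    (hh : LipschitzWith C h) (x : EuclideanSpace ℝ (Fin p)) : ‖gradient h x‖ ≤ C := by
  rw [gradient, LinearIsometryEquiv.norm_map]
  exact norm_fderiv_le_of_lipschitz ℝ hh

theorem fHat_eq_quadModel (L : ℝ) (f : Fin m → EuclideanSpace ℝ (Fin p) → ℝ)
    (x z : EuclideanSpace ℝ (Fin p)) :
    fHat L f x z = quadModel L (fun i => firstOrderOracle f i z) z x := rfl

theorem isInnerSolution_egtOutput [Nonempty (Fin m)] {C : NNReal}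
    {f : Fin m → EuclideanSpace ℝ (Fin p) → ℝ} (hL : 0 < L) (hε : 0 < ε)
    (hLip : ∀ i, LipschitzWith C (f i)) (x : EuclideanSpace ℝ (Fin p)) :
    IsInnerSolution L ε f x (egtOutput C L ε (fun i => firstOrderOracle f i x) x) := by
  intro w
  have ha : ∀ i, ‖(firstOrderOracle f i x).2‖ ≤ C := fun i => (hLip i).norm_gradient_le x
  rw [fHat_eq_quadModel, fHat_eq_quadModel]
  exact quadModel_egtOutput_le hL C.coe_nonneg hε ha w

end Accuracy

/-! ### Numerical complexity bounds -/

section Numerics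

variable {m : ℕ} {G ε : ℝ}

theorem two_mul_le_innerBound (hm : 2 ≤ m) (hε : 0 < ε) (hG : ε ≤ G) :
    2 * m ≤ innerBound m G ε := by
  have hm' : (2 : ℝ) ≤ m := by exact_mod_cast hm
  have hlog : (1 / 4 : ℝ) ≤ Real.log m := by
    linarith [Real.log_two_gt_d9, Real.log_le_log (by norm_num) hm']
  have hpow : (1 / 8 : ℝ) ≤ Real.log m ^ (3 / 2 : ℝ) := by
    have h1 : (1 / 4 : ℝ) ^ (3 / 2 : ℝ) = 1 / 8 := by
      rw [show (1 / 4 : ℝ) = (1 / 2) ^ (2 : ℝ) by norm_num, ← Real.rpow_mul (by norm_num)]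
      norm_num
    rw [← h1]
    exact Real.rpow_le_rpow (by norm_num) hlog (by norm_num)
  have hr : 1 ≤ G / ε := (one_le_div hε).2 hG
  have h2 : (2 * m : ℝ) ≤ 2 ^ 4 * G / ε * (m * Real.log m ^ (3 / 2 : ℝ)) := by
    calc (2 * m : ℝ) = 2 ^ 4 * 1 * (m * (1 / 8)) := by ring
      _ ≤ 2 ^ 4 * (G / ε) * (m * Real.log m ^ (3 / 2 : ℝ)) := by gcongr
      _ = _ := by ring
  have h3 := h2.trans (Nat.le_ceil _)
  exact Nat.cast_le.1 ((Nat.cast_mul 2 m).trans_le h3)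

theorem mul_egtSteps_le_innerBound (hm : 8 ≤ m) (hε : 0 < ε) (hG : ε ≤ G) :
    m * egtSteps m G ε ≤ innerBound m G ε := by
  have hm' : (8 : ℝ) ≤ m := by exact_mod_cast hm
  have hG0 : 0 < G := hε.trans_le hG
  have hlog : (2.07 : ℝ) ≤ Real.log m := by
    have h8 : Real.log 8 = 3 * Real.log 2 := by
      rw [show (8 : ℝ) = 2 ^ 3 by norm_num, Real.log_pow]; norm_num
    linarith [Real.log_two_gt_d9, Real.log_le_log (by norm_num) hm']
  set l := Real.log m with hl
  have hl0 : 0 < l := by linarith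
  have hsqrt : 1 ≤ Real.sqrt l := Real.one_le_sqrt.2 (by linarith)
  have hpow : l ^ (3 / 2 : ℝ) = l * Real.sqrt l := by
    rw [Real.sqrt_eq_rpow, ← Real.rpow_one_add' hl0.le (by norm_num)]
    norm_num
  have hr : 1 ≤ G / ε := (one_le_div hε).2 hG
  have hN : (egtSteps m G ε : ℝ) ≤ 2 ^ 5 * G * Real.sqrt l / ε + 1 :=
    (Nat.ceil_lt_add_one (by positivity)).le
  -- This absorbs the 1 lost to the ceiling in N. It needs 16 log m ≥ 33, which holds from m = 8 on.
  have h1 : 1 ≤ G / ε * (Real.sqrt l * (16 * l - 32)) :=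
    one_le_mul_of_one_le_of_one_le hr (one_le_mul_of_one_le_of_one_le hsqrt (by linarith))
  have h2 : (egtSteps m G ε : ℝ) ≤ 2 ^ 4 * G / ε * (l * Real.sqrt l) := by
    refine hN.trans ?_
    have e1 : 2 ^ 5 * G * Real.sqrt l / ε = 32 * (G / ε * Real.sqrt l) := by ring
    have e2 : 2 ^ 4 * G / ε * (l * Real.sqrt l) = 16 * (G / ε * Real.sqrt l) * l := by ring
    rw [e1, e2]
    linarith
  have h3 : (m * egtSteps m G ε : ℝ) ≤ 2 ^ 4 * G / ε * (m * l ^ (3 / 2 : ℝ)) := by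
    rw [hpow]
    calc (m * egtSteps m G ε : ℝ) ≤ m * (2 ^ 4 * G / ε * (l * Real.sqrt l)) := by gcongr
      _ = _ := by ring
  have h4 := h3.trans (Nat.le_ceil _)
  exact Nat.cast_le.1 ((Nat.cast_mul m _).trans_le h4)

theorem outerBound_pos {L Δ : ℝ} (hL : 0 < L) (hε : 0 < ε) (hΔ : 0 < Δ) :
    0 < outerBound L ε Δ :=
  Nat.ceil_pos.2 (by positivity)

end Numerics

/-! ### Assembly of the main theorem -/

theorem corollary1 {p m : ℕ} (hm : 0 < m) (f : Fin m → EuclideanSpace ℝ (Fin p) → ℝ)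
    (G : NNReal) (L ε fstar : ℝ) (hL : 0 < L) (hε : 0 < ε)
    (hLip : ∀ i, LipschitzWith G (f i)) (hSmooth : ∀ i, IsLSmooth L (f i))
    (hbdd : ∀ x, fstar ≤ maxFun f x) (x₀ : EuclideanSpace ℝ (Fin p)) :
    -- Prox-FDIAG with arbitrary inner solutions of the prescribed accuracy
    (∀ x : ℕ → EuclideanSpace ℝ (Fin p), x 0 = x₀ →
      (∀ k, IsInnerSolution L ε f (x k) (x (k + 1))) →
      ∃ k ≤ outerBound L ε (maxFun f x₀ - fstar),
        StopTest L ε f (x k) (x (k + 1)) ∧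
        (∀ j < k, ¬ StopTest L ε f (x j) (x (j + 1))) ∧
        IsEpsFOSP L ε (maxFun f) (x k)) ∧
    -- the excessive gap technique reaches this accuracy in `egtSteps m G ε` steps, without
    -- further queries
    (∀ z : EuclideanSpace ℝ (Fin p),
      let r := (egtSolve G L ε (fun i => firstOrderOracle f i z) z).run (firstOrderOracle f)
      IsInnerSolution L ε f z r.value ∧ r.queries = 0 ∧ r.innerSteps = egtSteps m G ε) ∧
    -- Prox-FDIAG with the excessive gap technique: output and complexity
    (∃ k ≤ outerBound L ε (maxFun f x₀ - fstar),
      ∃ (x : EuclideanSpace ℝ (Fin p)) (queries innerSteps : ℕ),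
        (∀ n, k < n →
          (proxFDIAG G L ε n 0 x₀).run (firstOrderOracle f)
            = ⟨some (k, x), queries, innerSteps⟩) ∧
        IsEpsFOSP L ε (maxFun f) x ∧
        (fstar < maxFun f x → k + 1 ≤ outerBound L ε (maxFun f x₀ - fstar)) ∧
        queries = (k + 1) * m ∧
        innerSteps = (k + 1) * egtSteps m G ε ∧
        (2 ≤ m → ε ≤ G → fstar < maxFun f x₀ →
          queries ≤ outerBound L ε (maxFun f x₀ - fstar) * innerBound m G ε) ∧
        (8 ≤ m → ε ≤ G → fstar < maxFun f x →
          m * innerSteps ≤ outerBound L ε (maxFun f x₀ - fstar) * innerBound m G ε)) := by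
  have : Nonempty (Fin m) := ⟨⟨0, hm⟩⟩
  refine ⟨?_, ?_, ?_⟩
  · rintro x rfl hin
    obtain ⟨k, hk, htest, hfirst, -⟩ := exists_first_stopTest hL hε hSmooth hbdd x
    exact ⟨k, hk, htest, hfirst, isEpsFOSP_of_stopTest hL hε hSmooth hbdd (hin k) htest⟩
  · intro z
    simp only [run_egtSolve, and_true]
    exact isInnerSolution_egtOutput hL hε hLip z
  · set next : EuclideanSpace ℝ (Fin p) → EuclideanSpace ℝ (Fin p) :=
      fun x => egtOutput G L ε (fun i => firstOrderOracle f i x) x with hnext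
    set x : ℕ → EuclideanSpace ℝ (Fin p) := fun k => next^[k] x₀ with hx
    have hx0 : x 0 = x₀ := rfl
    have hxs : ∀ k, x (k + 1) = next (x k) := fun k => Function.iterate_succ_apply' next k x₀
    obtain ⟨k, hk, htest, hfirst, hlt⟩ := exists_first_stopTest hL hε hSmooth hbdd x
    have hin : IsInnerSolution L ε f (x k) (x (k + 1)) := by
      rw [hxs]
      exact isInnerSolution_egtOutput hL hε hLip (x k)
    rw [hx0] at hk hlt
    refine ⟨k, hk, x k, _, _,
      fun n hn => run_proxFDIAG f G L ε hxs htest hfirst (zero_add k) hn,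
      isEpsFOSP_of_stopTest hL hε hSmooth hbdd hin htest, hlt, rfl, rfl, ?_, ?_⟩
    · intro hm2 hG hΔ
      have hK := outerBound_pos hL hε (sub_pos.2 hΔ)
      -- Here k may equal K, so the final test may cost a further round of m queries. Since K ≥ 1, k
      -- + 1 ≤ 2K, and the factor 2 is absorbed by 2m ≤ M.
      calc (k + 1) * m ≤ (2 * outerBound L ε (maxFun f x₀ - fstar)) * m := by gcongr; omega
        _ = outerBound L ε (maxFun f x₀ - fstar) * (2 * m) := by ring
        _ ≤ _ := Nat.mul_le_mul_left _ (two_mul_le_innerBound hm2 hε hG)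
    · intro hm8 hG hΔ
      calc m * ((k + 1) * egtSteps m G ε) = (k + 1) * (m * egtSteps m G ε) := by ring
        _ ≤ _ := Nat.mul_le_mul (hlt hΔ) (mul_egtSteps_le_innerBound hm8 hε hG)
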